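/- Consider real solutions of the first Painlevé equation $$y''(x)=6\,y(x)^2-x ,$$ each one defined on its interval of existence, i.e. the largest connected open subset of $\mathbb{R}$ on which the solution has no poles (the maximal open interval to which it extends as a real solution). Two solutions are regarded as different if their intervals of existence are different or if they take different values somewhere on a common interval of existence. The graphs of two solutions are said to intersect at the point at infinity with abscissa $p\in\mathbb{R}$ if $p$ is a common pole of them, i.e. if $p$ is a common (finite) end point of their intervals of existence. **Theorem.** The graphs of any two different real solutions have at most two points of intersection with non-positive abscissas, where finite points of intersection and points of intersection at infinity are both counted. -/

import Mathlib

namespace PainleveI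

/-- The real function `y` solves the first Painlevé equation `y'' = 6 y ^ 2 - x` at every point of
`I`. It is only used for open sets `I`, so that the derivatives at the points of `I` do not depend
on the values of `y` outside `I`. -/
def SolvesOn (I : Set ℝ) (y : ℝ → ℝ) : Prop :=
  ∀ x ∈ I, DifferentiableAt ℝ y x ∧ HasDerivAt (deriv y) (6 * y x ^ 2 - x) x

/-- `y` is a real solution of the first Painlevé equation with interval of existence `I`:
`I` is a nonempty open interval (possibly unbounded), `y` solves the equation on `I`, and `y` cannot
be continued as a real solution to a larger open interval. The values of `y` outside `I` play no
role. -/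
structure IsSolution (I : Set ℝ) (y : ℝ → ℝ) : Prop where
  isOpen : IsOpen I
  isConnected : IsConnected I
  solves : SolvesOn I y
  maximal : ∀ (J : Set ℝ) (z : ℝ → ℝ), IsOpen J → IsConnected J → I ⊆ J →
    SolvesOn J z → Set.EqOn z y I → J = I

/-- `p` is a (finite) end point of the nonempty interval `I`. For the interval of existence of a
solution, the finite end points are its poles. -/
def IsEndPoint (I : Set ℝ) (p : ℝ) : Prop :=
  IsGLB I p ∨ IsLUB I p

/-- The graph of the solution `y` with interval of existence `I`, completed by one point at
infinity `(p, ∞)` over every finite end point `p` of `I`. -/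
def extendedGraph (I : Set ℝ) (y : ℝ → ℝ) : Set (ℝ × OnePoint ℝ) :=
  {P | P.1 ∈ I ∧ P.2 = ((y P.1 : ℝ) : OnePoint ℝ)} ∪
    {P | IsEndPoint I P.1 ∧ P.2 = OnePoint.infty}

/-- The common points, finite or at infinity, of the graphs of two solutions. -/
def intersectionPoints (I₁ : Set ℝ) (y₁ : ℝ → ℝ) (I₂ : Set ℝ) (y₂ : ℝ → ℝ) :
    Set (ℝ × OnePoint ℝ) :=
  extendedGraph I₁ y₁ ∩ extendedGraph I₂ y₂

end PainleveI

/-! Put `w = y₁ - y₂` and `u = y₁ + y₂`; then `w'' = 6uw` and `u'' = 3u² + 3w² - 2x`. Suppose there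
are three intersections with abscissas `α < β < γ ≤ 0`. The middle one is finite, and `w'(β) ≠ 0` by
uniqueness. Moreover `w → 0` at `α` and `γ`, even at a common pole, since every solution is `(x -
b)⁻² + o(1)` at a pole `b` (`tendsto_sub_inv_sq`). The sign of `u'(β)` decides on which side of `β`
a contradiction arises (`SystemOn.false_of_tendsto`).

If `u'(β) ≥ 0`, take `w'(β) > 0` and let `η` be the first zero of `w'` after `β`, given by Rolle.
The energy `y'²/2 - 2y³ + xy` has derivative `y`, so the difference of the two energies increases
strictly while `w > 0`; yet it is nonnegative at `β` and nonpositive at `η ≤ 0`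
(`SystemOn.false_of_nonneg_right`).

If `u'(β) < 0`, take `w'(β) < 0` and let `ξ` be the last zero of `w'` before `β`. Then `u ≤ 0` on
`[ξ, β]`, and since `x ≤ 0`, `u` is at least as steep as the solution of `v'' = 3v²` with the same
data at `β`. A Wronskian of `w` with the linearization along `v` is nonnegative at `ξ` and stays so,
but is negative at `β` (`SystemOn.false_of_neg_left`). -/

namespace PainleveI

open Set Filter Topology

/-! ### Grönwall's inequality and uniqueness -/

/-- Grönwall-type positivity: if `f' ≥ h f` on `[a, b]` and `f a ≥ 0` then `f b ≥ 0`. -/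
theorem nonneg_of_mul_le_deriv {a b : ℝ} (hab : a ≤ b) {f f' h : ℝ → ℝ}
    (hh : ContinuousOn h (Icc a b)) (hf : ∀ x ∈ Icc a b, HasDerivAt f (f' x) x)
    (hge : ∀ x ∈ Icc a b, h x * f x ≤ f' x) (ha : 0 ≤ f a) : 0 ≤ f b := by
  -- Extending `h` by constants makes its primitive differentiable at the end points too, so `exp
  -- (-K)` is an integrating factor on the whole interval.
  set H : ℝ → ℝ := IccExtend hab ((Icc a b).domRestrict h) with hH
  have hHc : Continuous H := (continuousOn_iff_continuous_domRestrict.1 hh).Icc_extend'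
  have hHx : ∀ x ∈ Icc a b, H x = h x := fun x hx => by
    rw [hH, IccExtend_of_mem hab _ hx]; rfl
  set K : ℝ → ℝ := fun x => ∫ t in a..x, H t with hK
  have hKd : ∀ x, HasDerivAt K (H x) x := fun x => (hHc.integral_hasStrictDerivAt a x).hasDerivAt
  have hg : ∀ x ∈ Icc a b, HasDerivAt (fun x => f x * Real.exp (-K x))
      (f' x * Real.exp (-K x) + f x * (Real.exp (-K x) * -H x)) x := fun x hx =>
    (hf x hx).mul (hKd x).neg.exp
  have hmono : MonotoneOn (fun x => f x * Real.exp (-K x)) (Icc a b) := by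
    refine monotoneOn_of_hasDerivWithinAt_nonneg (convex_Icc a b)
      (fun x hx => (hg x hx).continuousAt.continuousWithinAt)
      (fun x hx => (hg x (interior_subset hx)).hasDerivWithinAt) (fun x hx => ?_)
    have hx' := interior_subset hx
    have h1 := hge x hx'
    rw [hHx x hx']
    have : 0 ≤ (f' x - h x * f x) * Real.exp (-K x) :=
      mul_nonneg (by linarith) (Real.exp_pos _).le
    linarith
  have h2 := hmono (left_mem_Icc.2 hab) (right_mem_Icc.2 hab) hab
  have h3 : 0 ≤ f b * Real.exp (-K b) := le_trans (mul_nonneg ha (Real.exp_pos _).le) h2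
  exact nonneg_of_mul_nonneg_left h3 (Real.exp_pos _)

/-- The first order system `y' = p`, `p' = 6 y ^ 2 + σ x`. For `σ = -1` this is the first Painlevé
equation, and the reflection `x ↦ -x` exchanges `σ` and `-σ`. -/
def SystemOn (σ : ℝ) (I : Set ℝ) (y p : ℝ → ℝ) : Prop :=
  ∀ x ∈ I, HasDerivAt y (p x) x ∧ HasDerivAt p (6 * y x ^ 2 + σ * x) x

theorem SystemOn.mono {σ : ℝ} {I J : Set ℝ} {y p : ℝ → ℝ} (h : SystemOn σ I y p) (hJ : J ⊆ I) :
    SystemOn σ J y p := fun x hx => h x (hJ hx)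

theorem SolvesOn.systemOn {I : Set ℝ} {y : ℝ → ℝ} (h : SolvesOn I y) :
    SystemOn (-1) I y (deriv y) := fun x hx => by
  refine ⟨(h x hx).1.hasDerivAt, ?_⟩
  have := (h x hx).2
  rwa [show 6 * y x ^ 2 + -1 * x = 6 * y x ^ 2 - x by ring]

theorem SystemOn.solvesOn {I : Set ℝ} (hI : IsOpen I) {y p : ℝ → ℝ} (h : SystemOn (-1) I y p) :
    SolvesOn I y := fun x hx => by
  refine ⟨(h x hx).1.differentiableAt, ?_⟩
  have hp := (h x hx).2
  rw [show 6 * y x ^ 2 + -1 * x = 6 * y x ^ 2 - x by ring] at hp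
  refine hp.congr_of_eventuallyEq ?_
  filter_upwards [hI.mem_nhds hx] with t ht using (h t ht).1.deriv

theorem SystemOn.reflect {σ : ℝ} {I : Set ℝ} {y p : ℝ → ℝ} (h : SystemOn σ I y p) :
    SystemOn (-σ) {x | -x ∈ I} (fun x => y (-x)) (fun x => -p (-x)) := fun x hx => by
  obtain ⟨h1, h2⟩ := h (-x) hx
  refine ⟨?_, ?_⟩
  · simpa [Function.comp_def] using h1.scomp x (hasDerivAt_neg x)
  · exact (h2.scomp x (hasDerivAt_neg x)).neg.congr_deriv (by rw [smul_eq_mul]; ring)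

/-- With `D = (y - z)² + (p - q)²` one has `D' = 2(y - z)(p - q)(1 + 6(y + z)) ≤ (1 + 6|y + z|) D`.
Grönwall applied to `-D` keeps `D` from growing away from zero. -/
theorem SystemOn.eq_right {σ a b : ℝ} (hab : a ≤ b) {y p z q : ℝ → ℝ}
    (hy : SystemOn σ (Icc a b) y p) (hz : SystemOn σ (Icc a b) z q)
    (h0 : y a = z a) (h1 : p a = q a) : y b = z b := by
  have hc : ContinuousOn (fun x => 1 + 6 * |y x + z x|) (Icc a b) := by
    have hyc : ContinuousOn y (Icc a b) := fun x hx => (hy x hx).1.continuousAt.continuousWithinAt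
    have hzc : ContinuousOn z (Icc a b) := fun x hx => (hz x hx).1.continuousAt.continuousWithinAt
    fun_prop
  have key := nonneg_of_mul_le_deriv hab (f := fun x => -((y x - z x) ^ 2 + (p x - q x) ^ 2))
    (f' := fun x => -(2 * (y x - z x) * (p x - q x) * (1 + 6 * (y x + z x)))) hc
    (fun x hx => by
      obtain ⟨h1, h2⟩ := hy x hx
      obtain ⟨h3, h4⟩ := hz x hx
      refine (((h1.sub h3).pow 2).add ((h2.sub h4).pow 2)).neg.congr_deriv ?_
      simp only [Pi.sub_apply]
      push_cast
      ring)
    (fun x hx => by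
      set s := y x - z x
      set d := p x - q x
      set u := y x + z x
      have e1 : |2 * s * d| ≤ s ^ 2 + d ^ 2 := by
        rw [abs_le]; constructor <;> nlinarith [sq_nonneg (s - d), sq_nonneg (s + d)]
      have e2 : |1 + 6 * u| ≤ 1 + 6 * |u| := by
        calc |1 + 6 * u| ≤ |1| + |6 * u| := abs_add_le _ _
          _ = 1 + 6 * |u| := by rw [abs_mul]; norm_num
      have e3 : 2 * s * d * (1 + 6 * u) ≤ (s ^ 2 + d ^ 2) * (1 + 6 * |u|) :=
        calc _ ≤ |2 * s * d * (1 + 6 * u)| := le_abs_self _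
          _ = |2 * s * d| * |1 + 6 * u| := abs_mul _ _
          _ ≤ _ := by gcongr
      show (1 + 6 * |u|) * -(s ^ 2 + d ^ 2) ≤ -(2 * s * d * (1 + 6 * u))
      linarith)
    (by simp [h0, h1])
  have : (y b - z b) ^ 2 ≤ 0 := by nlinarith [sq_nonneg (p b - q b)]
  have := pow_eq_zero_iff (two_ne_zero) |>.1 (le_antisymm this (sq_nonneg _))
  linarith

/-- Solutions with the same initial values agree. -/
theorem SystemOn.eqOn {σ : ℝ} {J : Set ℝ} (hJ : J.OrdConnected) {y p z q : ℝ → ℝ}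
    (hy : SystemOn σ J y p) (hz : SystemOn σ J z q) {a : ℝ} (ha : a ∈ J)
    (h0 : y a = z a) (h1 : p a = q a) : EqOn y z J := by
  intro b hb
  rcases le_total a b with hab | hab
  · exact (hy.mono (hJ.out ha hb)).eq_right hab (hz.mono (hJ.out ha hb)) h0 h1
  · have hsub : Icc (-a) (-b) ⊆ {x | -x ∈ J} := fun x hx =>
      hJ.out hb ha ⟨by linarith [hx.2], by linarith [hx.1]⟩
    have := (hy.reflect.mono hsub).eq_right (neg_le_neg hab) (hz.reflect.mono hsub)
      (by simpa using h0) (by simpa using h1)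
    simpa using this

/-! ### Continuation and blow-up at an end point -/

/-- A solution cannot be continued by a solution with which it agrees on the overlap. -/
theorem IsSolution.subset {I J : Set ℝ} {y z : ℝ → ℝ} (h : IsSolution I y) (hJ : IsOpen J)
    (hJc : IsPreconnected J) (hIJ : (I ∩ J).Nonempty) (hz : SolvesOn J z)
    (heq : EqOn z y (I ∩ J)) : J ⊆ I := by
  classical
  set Y : ℝ → ℝ := fun x => if x ∈ I then y x else z x with hY
  have hYI : EqOn Y y I := fun x hx => by simp [hY, hx]
  have hYJ : EqOn Y z J := fun x hx => by
    by_cases hx' : x ∈ I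
    · simp [hY, hx', heq ⟨hx', hx⟩]
    · simp [hY, hx']
  have congr : ∀ {U : Set ℝ} {f : ℝ → ℝ}, IsOpen U → SolvesOn U f → EqOn Y f U → SolvesOn U Y := by
    intro U f hU hf hfe x hx
    have e : Y =ᶠ[𝓝 x] f := hfe.eventuallyEq_of_mem (hU.mem_nhds hx)
    refine ⟨(hf x hx).1.congr_of_eventuallyEq e, ?_⟩
    rw [hfe hx]
    exact (hf x hx).2.congr_of_eventuallyEq e.deriv
  have hs : SolvesOn (I ∪ J) Y := fun x hx => hx.elim
    (fun hx => congr h.isOpen h.solves hYI x hx) (fun hx => congr hJ hz hYJ x hx)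
  have hc : IsConnected (I ∪ J) :=
    ⟨h.isConnected.nonempty.mono subset_union_left,
      h.isConnected.isPreconnected.union' hIJ hJc⟩
  have := h.maximal _ Y (h.isOpen.union hJ) hc subset_union_left hs hYI
  exact this ▸ subset_union_right

theorem exists_Ioo_of_eventually_nhdsLT {b : ℝ} {P : ℝ → Prop} (h : ∀ᶠ x in 𝓝[<] b, P x) :
    ∃ s < b, ∀ x ∈ Ioo s b, P x :=
  (mem_nhdsLT_iff_exists_Ioo_subset' (sub_one_lt b)).1 h

theorem eventually_mem_Ioo_nhdsLT {s b : ℝ} (h : s < b) : ∀ᶠ x in 𝓝[<] b, x ∈ Ioo s b :=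
  Ioo_mem_nhdsLT h

/-- A function whose derivative is bounded below has a limit at a right end point, possibly
infinite. -/
theorem tendsto_nhds_or_atTop_of_le_deriv {b C : ℝ} {f f' : ℝ → ℝ}
    (h : ∀ᶠ x in 𝓝[<] b, HasDerivAt f (f' x) x ∧ C ≤ f' x) :
    (∃ l, Tendsto f (𝓝[<] b) (𝓝 l)) ∨ Tendsto f (𝓝[<] b) atTop := by
  obtain ⟨s, hs, h⟩ := exists_Ioo_of_eventually_nhdsLT h
  have hg : ∀ x ∈ Ioo s b, HasDerivAt (fun x => f x - C * x) (f' x - C * 1) x := fun x hx =>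
    (h x hx).1.sub ((hasDerivAt_id x).const_mul C)
  have hmono : MonotoneOn (fun x => f x - C * x) (Ioo s b) := by
    refine monotoneOn_of_hasDerivWithinAt_nonneg (convex_Ioo s b)
      (fun x hx => (hg x hx).continuousAt.continuousWithinAt)
      (fun x hx => (hg x (interior_subset hx)).hasDerivWithinAt) (fun x hx => ?_)
    linarith [(h x (interior_subset hx)).2]
  have hlin : Tendsto (fun x => C * x) (𝓝[<] b) (𝓝 (C * b)) :=
    (Continuous.tendsto (by fun_prop) b).mono_left nhdsWithin_le_nhds
  have hsum : f = fun x => (f x - C * x) + C * x := by ext x; ring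
  by_cases hb : BddAbove ((fun x => f x - C * x) '' Ioo s b)
  · left
    have := (hmono.tendsto_nhdsWithin_Ioo_left (nonempty_Ioo.2 hs) hb).add hlin
    exact ⟨_, by rwa [hsum]⟩
  · right
    have : Tendsto (fun x => f x - C * x) (𝓝[<] b) atTop := by
      refine tendsto_atTop.2 fun B => ?_
      rw [not_bddAbove_iff] at hb
      obtain ⟨_, ⟨m, hm, rfl⟩, hB⟩ := hb B
      filter_upwards [eventually_mem_Ioo_nhdsLT hm.2] with x hx
      exact hB.le.trans (hmono hm ⟨hm.1.trans hx.1, hx.2⟩ hx.1.le)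
    rw [hsum]
    exact this.atTop_add hlin

theorem not_tendsto_atTop_of_deriv_le {b C : ℝ} {f f' : ℝ → ℝ}
    (h : ∀ᶠ x in 𝓝[<] b, HasDerivAt f (f' x) x ∧ f' x ≤ C) :
    ¬ Tendsto f (𝓝[<] b) atTop := by
  intro hf
  have h' : ∀ᶠ x in 𝓝[<] b, HasDerivAt (fun x => -f x) (-f' x) x ∧ -C ≤ -f' x := by
    filter_upwards [h] with x hx using ⟨hx.1.neg, neg_le_neg hx.2⟩
  have hbot : Tendsto (fun x => -f x) (𝓝[<] b) atBot := tendsto_neg_atTop_atBot.comp hf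
  rcases tendsto_nhds_or_atTop_of_le_deriv h' with ⟨l, hl⟩ | ht
  · exact not_tendsto_nhds_of_tendsto_atBot hbot l hl
  · exact hbot.not_tendsto disjoint_atBot_atTop ht

/-- A function that tends to zero at the right end point is controlled by its derivative. -/
theorem abs_le_mul_of_abs_deriv_le {x b M : ℝ} (hx : x < b) {g g' : ℝ → ℝ}
    (hg : ∀ t ∈ Ico x b, HasDerivAt g (g' t) t) (hM : ∀ t ∈ Ico x b, |g' t| ≤ M)
    (h0 : Tendsto g (𝓝[<] b) (𝓝 0)) : |g x| ≤ M * (b - x) := by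
  have key : ∀ t ∈ Ico x b, |g x| ≤ |g t| + M * (b - x) := fun t ht => by
    have h1 := (convex_Ico x b).norm_image_sub_le_of_norm_hasDerivWithin_le
      (fun s hs => (hg s hs).hasDerivWithinAt) hM ht (left_mem_Ico.2 hx)
    simp only [Real.norm_eq_abs] at h1
    have h2 : |x - t| ≤ b - x := by rw [abs_le]; constructor <;> linarith [ht.1, ht.2]
    have hM0 : 0 ≤ M := (abs_nonneg _).trans (hM t ht)
    have h3 := mul_le_mul_of_nonneg_left h2 hM0
    have h4 := abs_sub_abs_le_abs_sub (g x) (g t)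
    linarith
  have hlim : Tendsto (fun t => |g t| + M * (b - x)) (𝓝[<] b) (𝓝 (|0| + M * (b - x))) :=
    h0.abs.add_const _
  rw [abs_zero, zero_add] at hlim
  refine ge_of_tendsto hlim ?_
  filter_upwards [eventually_mem_Ioo_nhdsLT hx] with t ht using key t ⟨ht.1.le, ht.2⟩

/-- A solution with finite limits at the right end point can be continued. -/
theorem SystemOn.exists_extension {σ a b y₀ p₀ : ℝ} (hab : a < b) {y p : ℝ → ℝ}
    (h : SystemOn σ (Ioo a b) y p) (hy : Tendsto y (𝓝[<] b) (𝓝 y₀))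
    (hp : Tendsto p (𝓝[<] b) (𝓝 p₀)) :
    ∃ s c, a ≤ s ∧ s < b ∧ b < c ∧ ∃ z q, SystemOn σ (Ioo s c) z q ∧ EqOn z y (Ioo s b) := by
  -- With `x` as a third unknown the system is autonomous, and the existence time `ε` is uniform for
  -- initial points near `(b, y₀, p₀)`. Starting at `t > b - ε` therefore leads past `b`.
  set f : ℝ × ℝ × ℝ → ℝ × ℝ × ℝ := fun v => (1, v.2.2, 6 * v.2.1 ^ 2 + σ * v.1) with hf
  have hfc : ContDiff ℝ 1 f := by rw [hf]; fun_prop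
  obtain ⟨r, hr, ε, hε, H⟩ := (hfc.contDiffAt (x := (b, y₀, p₀))
    ).exists_forall_mem_closedBall_exists_eq_forall_mem_Ioo_hasDerivAt 0
  have hid : Tendsto (fun x : ℝ => x) (𝓝[<] b) (𝓝 b) := nhdsWithin_le_nhds
  have hlim : Tendsto (fun x => (x, y x, p x)) (𝓝[<] b) (𝓝 (b, y₀, p₀)) :=
    hid.prodMk_nhds (hy.prodMk_nhds hp)
  obtain ⟨t, ht1, ht2, ht3⟩ := ((hlim.eventually (Metric.closedBall_mem_nhds _ hr)).and
    ((eventually_mem_Ioo_nhdsLT hab).and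
      (eventually_mem_Ioo_nhdsLT (sub_lt_self b hε)))).exists
  obtain ⟨α, hα0, hα⟩ := H _ ht1
  have hα1 : ∀ x ∈ Ioo (0 - ε) (0 + ε), HasDerivAt (fun x => (α x).1) 1 x := fun x hx =>
    (hα x hx).fst
  have hfst : ∀ x ∈ Ioo (0 - ε) (0 + ε), (α x).1 = t + x := by
    intro x hx
    have hd : ∀ s ∈ Ioo (0 - ε) (0 + ε), HasDerivAt (fun x => (α x).1 - x) (1 - 1) s :=
      fun s hs => (hα1 s hs).sub (hasDerivAt_id s)
    have := isOpen_Ioo.is_const_of_deriv_eq_zero isPreconnected_Ioo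
      (fun s hs => (hd s hs).differentiableAt.differentiableWithinAt)
      (fun s hs => by rw [(hd s hs).deriv]; simp) hx (y := 0) (by simp [hε])
    simp only [hα0] at this
    linarith
  have hz : SystemOn σ (Ioo (t - ε) (t + ε)) (fun x => (α (x - t)).2.1)
      (fun x => (α (x - t)).2.2) := fun x hx => by
    have hx' : x - t ∈ Ioo (0 - ε) (0 + ε) := ⟨by linarith [hx.1], by linarith [hx.2]⟩
    have hs := (hα _ hx').comp_sub_const x t
    have h2 : HasDerivAt (fun x => (α (x - t)).2) (f (α (x - t))).2 x := hs.snd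
    have h3 : HasDerivAt (fun x => (α (x - t)).2.2) (f (α (x - t))).2.2 x := h2.snd
    refine ⟨h2.fst, h3.congr_deriv ?_⟩
    simp only [hf, hfst _ hx']
    ring
  refine ⟨max a (t - ε), t + ε, le_max_left _ _, max_lt hab (by linarith [ht2.2]),
    by linarith [ht3.1], _, _, hz.mono (Ioo_subset_Ioo_left (le_max_right _ _)), ?_⟩
  refine SystemOn.eqOn ordConnected_Ioo (a := t)
    (hz.mono (Ioo_subset_Ioo (le_max_right _ _) (by linarith [ht3.1])))
    (h.mono (Ioo_subset_Ioo_left (le_max_left _ _)))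
    ⟨max_lt ht2.1 (by linarith), ht2.2⟩ ?_ ?_
  · simp [hα0]
  · simp [hα0]

/-- A solution without finite limits at the right end point tends to infinity there. -/
theorem SystemOn.tendsto_atTop {σ a b : ℝ} (hab : a < b) {y p : ℝ → ℝ}
    (h : SystemOn σ (Ioo a b) y p)
    (hne : ∀ y₀ p₀, Tendsto y (𝓝[<] b) (𝓝 y₀) → ¬ Tendsto p (𝓝[<] b) (𝓝 p₀)) :
    Tendsto y (𝓝[<] b) atTop ∧ Tendsto p (𝓝[<] b) atTop := by
  have hev : ∀ᶠ x in 𝓝[<] b, HasDerivAt y (p x) x ∧ HasDerivAt p (6 * y x ^ 2 + σ * x) x :=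
    (eventually_mem_Ioo_nhdsLT hab).mono h
  have hσ : Tendsto (fun x => σ * x) (𝓝[<] b) (𝓝 (σ * b)) :=
    (Continuous.tendsto (by fun_prop) b).mono_left nhdsWithin_le_nhds
  -- `p'` is bounded below near `b`, so `p` converges or tends to infinity. If `p` converged, `y' =
  -- p` would be bounded and `y` would converge as well.
  have hpt : Tendsto p (𝓝[<] b) atTop := by
    have hp : ∀ᶠ x in 𝓝[<] b, HasDerivAt p (6 * y x ^ 2 + σ * x) x ∧
        σ * b - 1 ≤ 6 * y x ^ 2 + σ * x := by
      filter_upwards [hev, hσ.eventually_const_lt (sub_one_lt _)] with x hx hx'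
      exact ⟨hx.2, by nlinarith [sq_nonneg (y x)]⟩
    rcases tendsto_nhds_or_atTop_of_le_deriv hp with ⟨p₀, hp₀⟩ | hp
    · exfalso
      have h1 : ∀ᶠ x in 𝓝[<] b, HasDerivAt y (p x) x ∧ p₀ - 1 ≤ p x := by
        filter_upwards [hev, hp₀.eventually_const_lt (sub_one_lt _)] with x hx hx'
        exact ⟨hx.1, hx'.le⟩
      have h2 : ∀ᶠ x in 𝓝[<] b, HasDerivAt y (p x) x ∧ p x ≤ p₀ + 1 := by
        filter_upwards [hev, hp₀.eventually_lt_const (lt_add_one _)] with x hx hx'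
        exact ⟨hx.1, hx'.le⟩
      rcases tendsto_nhds_or_atTop_of_le_deriv h1 with ⟨y₀, hy₀⟩ | hy
      · exact hne y₀ p₀ hy₀ hp₀
      · exact not_tendsto_atTop_of_deriv_le h2 hy
    · exact hp
  refine ⟨?_, hpt⟩
  have h1 : ∀ᶠ x in 𝓝[<] b, HasDerivAt y (p x) x ∧ 0 ≤ p x := by
    filter_upwards [hev, hpt.eventually_ge_atTop 0] with x hx hx' using ⟨hx.1, hx'⟩
  rcases tendsto_nhds_or_atTop_of_le_deriv h1 with ⟨y₀, hy₀⟩ | hy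
  · exfalso
    have hd : Tendsto (fun x => 6 * y x ^ 2 + σ * x) (𝓝[<] b) (𝓝 (6 * y₀ ^ 2 + σ * b)) :=
      ((hy₀.pow 2).const_mul 6).add hσ
    have h2 : ∀ᶠ x in 𝓝[<] b, HasDerivAt p (6 * y x ^ 2 + σ * x) x ∧
        6 * y x ^ 2 + σ * x ≤ 6 * y₀ ^ 2 + σ * b + 1 := by
      filter_upwards [hev, hd.eventually_lt_const (lt_add_one _)] with x hx hx'
      exact ⟨hx.2, hx'.le⟩
    exact not_tendsto_atTop_of_deriv_le h2 hpt
  · exact hy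

/-! ### Asymptotics at a pole -/

/-- Near a pole, `p ^ 2 = 4 y ^ 3 + O(y)`. -/
theorem exists_abs_sq_sub_le {σ b : ℝ} {y p : ℝ → ℝ}
    (h : ∀ᶠ x in 𝓝[<] b, HasDerivAt y (p x) x ∧ HasDerivAt p (6 * y x ^ 2 + σ * x) x)
    (hy : Tendsto y (𝓝[<] b) atTop) (hp : Tendsto p (𝓝[<] b) atTop) :
    ∃ C, ∀ᶠ x in 𝓝[<] b, |p x ^ 2 - 4 * y x ^ 3| ≤ C * y x := by
  have hσ : Tendsto (fun x => |σ * x|) (𝓝[<] b) (𝓝 |σ * b|) :=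
    (Continuous.tendsto (by fun_prop) b).mono_left nhdsWithin_le_nhds
  -- Near `b`, `|σx| ≤ K`, so `|(p² - 4y³)'| = |2pσx| ≤ 2Kp = (2Ky)'`; hence `p² - 4y³ ∓ 2Ky` are
  -- monotone.
  set K := |σ * b| + 1 with hK
  obtain ⟨s, hs, H⟩ := exists_Ioo_of_eventually_nhdsLT
    ((h.and (hp.eventually_ge_atTop 0)).and (hσ.eventually_lt_const (lt_add_one _)))
  have hd : ∀ x ∈ Ioo s b, HasDerivAt (fun x => p x ^ 2 - 4 * y x ^ 3) (2 * p x * (σ * x)) x :=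
    fun x hx => by
      obtain ⟨⟨⟨h1, h2⟩, -⟩, -⟩ := H x hx
      refine ((h2.pow 2).sub ((h1.pow 3).const_mul 4)).congr_deriv ?_
      push_cast
      ring
  have hb : ∀ x ∈ Ioo s b, |2 * p x * (σ * x)| ≤ 2 * K * p x := fun x hx => by
    obtain ⟨⟨-, h1⟩, h2⟩ := H x hx
    rw [abs_mul, abs_of_nonneg (by linarith : 0 ≤ 2 * p x)]
    nlinarith
  have hup : AntitoneOn (fun x => p x ^ 2 - 4 * y x ^ 3 - 2 * K * y x) (Ioo s b) := by
    have hd' : ∀ x ∈ Ioo s b, HasDerivAt (fun x => p x ^ 2 - 4 * y x ^ 3 - 2 * K * y x)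
        (2 * p x * (σ * x) - 2 * K * p x) x :=
      fun x hx => (hd x hx).sub ((H x hx).1.1.1.const_mul _)
    refine antitoneOn_of_hasDerivWithinAt_nonpos (convex_Ioo s b)
      (fun x hx => (hd' x hx).continuousAt.continuousWithinAt)
      (fun x hx => (hd' x (interior_subset hx)).hasDerivWithinAt) (fun x hx => ?_)
    linarith [(abs_le.1 (hb x (interior_subset hx))).2]
  have hlo : MonotoneOn (fun x => p x ^ 2 - 4 * y x ^ 3 + 2 * K * y x) (Ioo s b) := by
    have hd' : ∀ x ∈ Ioo s b, HasDerivAt (fun x => p x ^ 2 - 4 * y x ^ 3 + 2 * K * y x)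
        (2 * p x * (σ * x) + 2 * K * p x) x :=
      fun x hx => (hd x hx).add ((H x hx).1.1.1.const_mul _)
    refine monotoneOn_of_hasDerivWithinAt_nonneg (convex_Ioo s b)
      (fun x hx => (hd' x hx).continuousAt.continuousWithinAt)
      (fun x hx => (hd' x (interior_subset hx)).hasDerivWithinAt) (fun x hx => ?_)
    linarith [(abs_le.1 (hb x (interior_subset hx))).1]
  obtain ⟨m, hm⟩ := nonempty_Ioo.2 hs
  refine ⟨2 * K + |p m ^ 2 - 4 * y m ^ 3 - 2 * K * y m| + |p m ^ 2 - 4 * y m ^ 3 + 2 * K * y m|, ?_⟩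
  filter_upwards [eventually_mem_Ioo_nhdsLT hm.2, hy.eventually_ge_atTop 1] with x hx hyx
  have hx' : x ∈ Ioo s b := ⟨hm.1.trans hx.1, hx.2⟩
  have h1 := hup hm hx' hx.1.le
  have h2 := hlo hm hx' hx.1.le
  simp only at h1 h2
  set A := p m ^ 2 - 4 * y m ^ 3 - 2 * K * y m
  set B := p m ^ 2 - 4 * y m ^ 3 + 2 * K * y m
  have hA : |A| ≤ |A| * y x := le_mul_of_one_le_right (abs_nonneg _) hyx
  have hB : |B| ≤ |B| * y x := le_mul_of_one_le_right (abs_nonneg _) hyx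
  rw [abs_le]
  constructor
  · nlinarith [neg_abs_le B, abs_nonneg A]
  · nlinarith [le_abs_self A, abs_nonneg B]

/-- Near a pole `b` of a solution, `y ^ (-1 / 2) = (b - x) + O((b - x) ^ 5)`. -/
theorem exists_abs_inv_sqrt_sub_le {σ b : ℝ} {y p : ℝ → ℝ}
    (h : ∀ᶠ x in 𝓝[<] b, HasDerivAt y (p x) x ∧ HasDerivAt p (6 * y x ^ 2 + σ * x) x)
    (hy : Tendsto y (𝓝[<] b) atTop) (hp : Tendsto p (𝓝[<] b) atTop) :
    ∃ C, ∀ᶠ x in 𝓝[<] b, |(√(y x))⁻¹ - (b - x)| ≤ C * (b - x) ^ 5 := by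
  obtain ⟨C, hC⟩ := exists_abs_sq_sub_le h hy hp
  have hv0 : Tendsto (fun x => (√(y x))⁻¹) (𝓝[<] b) (𝓝 0) :=
    tendsto_inv_atTop_zero.comp (Real.tendsto_sqrt_atTop.comp hy)
  have hg0 : Tendsto (fun x => (√(y x))⁻¹ - (b - x)) (𝓝[<] b) (𝓝 0) := by
    have : Tendsto (fun x : ℝ => b - x) (𝓝[<] b) (𝓝 (b - b)) :=
      (Continuous.tendsto (by fun_prop) b).mono_left nhdsWithin_le_nhds
    simpa using hv0.sub this
  have hd : ∀ᶠ x in 𝓝[<] b, HasDerivAt (fun x => (√(y x))⁻¹ - (b - x))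
      (1 - p x / (2 * √(y x) ^ 3)) x ∧ |1 - p x / (2 * √(y x) ^ 3)| ≤ C / 4 * (√(y x))⁻¹ ^ 4 := by
    filter_upwards [h, hC, hy.eventually_gt_atTop 0, hp.eventually_ge_atTop 0]
      with x hx hCx hyx hpx
    have hr : 0 < √(y x) := Real.sqrt_pos.2 hyx
    have hrs : y x = √(y x) ^ 2 := (Real.sq_sqrt hyx.le).symm
    constructor
    · refine (((hx.1.sqrt hyx.ne').inv hr.ne').sub ((hasDerivAt_id x).const_sub b)).congr_deriv ?_
      field_simp
      ring
    · set r := √(y x)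
      rw [hrs] at hCx
      set ρ := p x / (2 * r ^ 3) with hρ
      have hρ0 : 0 ≤ ρ := by positivity
      -- The energy estimate bounds `1 - ρ² = (1 - ρ)(1 + ρ)`; the factor `1 + ρ ≥ 1` can be
      -- dropped.
      have e1 : p x ^ 2 - 4 * (r ^ 2) ^ 3 = -(4 * r ^ 6) * ((1 - ρ) * (1 + ρ)) := by
        rw [hρ]; field_simp; ring
      rw [e1, abs_mul, abs_neg, abs_of_pos (by positivity : 0 < 4 * r ^ 6), abs_mul,
        abs_of_pos (by positivity : 0 < 1 + ρ)] at hCx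
      have h2 : 4 * r ^ 6 * |1 - ρ| ≤ C * r ^ 2 := by
        refine le_trans ?_ hCx
        have : |1 - ρ| ≤ |1 - ρ| * (1 + ρ) := le_mul_of_one_le_right (abs_nonneg _) (by linarith)
        gcongr
      have h3 : C / 4 * r⁻¹ ^ 4 = C * r ^ 2 / (4 * r ^ 6) := by field_simp
      rw [h3, le_div_iff₀ (by positivity)]
      linarith
  have hlim : Tendsto (fun x => C / 4 * (√(y x))⁻¹ ^ 4) (𝓝[<] b) (𝓝 0) := by
    simpa using (hv0.pow 4).const_mul (C / 4)
  have hC0 : 0 ≤ C := by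
    obtain ⟨x, hx1, hx2⟩ := (hC.and (hy.eventually_gt_atTop 0)).exists
    exact nonneg_of_mul_nonneg_left ((abs_nonneg _).trans hx1) hx2
  obtain ⟨s, hs, H⟩ := exists_Ioo_of_eventually_nhdsLT
    (hd.and (hlim.eventually_lt_const one_pos))
  -- Bootstrap: the crude bound 1 on the derivative gives `y ^ (-1/2) ≤ 2(b - x)`, and inserting
  -- this into the bound `C/4 · y⁻²` produces the fifth power.
  have hv2 : ∀ x ∈ Ioo s b, (√(y x))⁻¹ ≤ 2 * (b - x) := fun x hx => by
    have hsub : ∀ t ∈ Ico x b, t ∈ Ioo s b := fun t ht => ⟨hx.1.trans_le ht.1, ht.2⟩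
    have := abs_le_mul_of_abs_deriv_le hx.2 (fun t ht => (H t (hsub t ht)).1.1) (M := 1)
      (fun t ht => (H t (hsub t ht)).1.2.trans (H t (hsub t ht)).2.le) hg0
    linarith [(abs_le.1 this).2]
  refine ⟨C / 4 * 2 ^ 4, ?_⟩
  filter_upwards [eventually_mem_Ioo_nhdsLT hs] with x hx
  have hsub : ∀ t ∈ Ico x b, t ∈ Ioo s b := fun t ht => ⟨hx.1.trans_le ht.1, ht.2⟩
  have := abs_le_mul_of_abs_deriv_le hx.2 (fun t ht => (H t (hsub t ht)).1.1)
    (M := C / 4 * (2 * (b - x)) ^ 4)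
    (fun t ht => (H t (hsub t ht)).1.2.trans (by
      have h1 := hv2 t (hsub t ht)
      have h2 : (√(y t))⁻¹ ≤ 2 * (b - x) := by linarith [ht.1]
      gcongr)) hg0
  calc _ ≤ _ := this
    _ = _ := by ring

/-- Near a pole `b` of a solution, `y = (b - x) ^ (-2) + o(1)`. -/
theorem tendsto_sub_inv_sq {σ b : ℝ} {y p : ℝ → ℝ}
    (h : ∀ᶠ x in 𝓝[<] b, HasDerivAt y (p x) x ∧ HasDerivAt p (6 * y x ^ 2 + σ * x) x)
    (hy : Tendsto y (𝓝[<] b) atTop) (hp : Tendsto p (𝓝[<] b) atTop) :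
    Tendsto (fun x => y x - ((b - x) ^ 2)⁻¹) (𝓝[<] b) (𝓝 0) := by
  obtain ⟨C, hC⟩ := exists_abs_inv_sqrt_sub_le h hy hp
  have ht : Tendsto (fun x : ℝ => b - x) (𝓝[<] b) (𝓝 0) := by
    have : Tendsto (fun x : ℝ => b - x) (𝓝[<] b) (𝓝 (b - b)) :=
      (Continuous.tendsto (by fun_prop) b).mono_left nhdsWithin_le_nhds
    simpa using this
  have h4 : Tendsto (fun x : ℝ => C * (b - x) ^ 4) (𝓝[<] b) (𝓝 0) := by
    simpa using (ht.pow 4).const_mul C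
  -- The constant is `10 = 5/2 · 4`, from `v + t ≤ 5/2 · t` and `v² ≥ t²/4` below, where `v = y ^
  -- (-1/2)` and `t = b - x`.
  have h2 : Tendsto (fun x : ℝ => 10 * C * (b - x) ^ 2) (𝓝[<] b) (𝓝 0) := by
    simpa using (ht.pow 2).const_mul (10 * C)
  refine squeeze_zero_norm' ?_ h2
  filter_upwards [hC, h4.eventually_lt_const (by norm_num : (0 : ℝ) < 1 / 2),
    hy.eventually_gt_atTop 0, self_mem_nhdsWithin] with x hx h4x hyx hxb
  have hr : 0 < √(y x) := Real.sqrt_pos.2 hyx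
  have hyr : y x = ((√(y x))⁻¹ ^ 2)⁻¹ := by rw [inv_pow, inv_inv, Real.sq_sqrt hyx.le]
  rw [Real.norm_eq_abs, hyr]
  set v := (√(y x))⁻¹
  have hv : 0 < v := inv_pos.2 hr
  have htx : 0 < b - x := sub_pos.2 hxb
  set t := b - x
  have hvt : |v - t| ≤ t / 2 := hx.trans (by
    calc C * t ^ 5 = C * t ^ 4 * t := by ring
      _ ≤ 1 / 2 * t := by gcongr
      _ = t / 2 := by ring)
  have hv1 : t / 2 ≤ v := by linarith [(abs_le.1 hvt).1]
  have hv2 : v + t ≤ 5 / 2 * t := by linarith [(abs_le.1 hvt).2]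
  have e : (v ^ 2)⁻¹ - (t ^ 2)⁻¹ = (t - v) * (v + t) / (v ^ 2 * t ^ 2) := by
    field_simp; ring
  have hCt : 0 ≤ C * t ^ 5 := (abs_nonneg _).trans hx
  rw [e, abs_div, abs_mul, abs_sub_comm, abs_of_pos (by positivity : 0 < v + t),
    abs_of_pos (by positivity : 0 < v ^ 2 * t ^ 2), div_le_iff₀ (by positivity)]
  have hC0 : 0 ≤ C := nonneg_of_mul_nonneg_left hCt (by positivity)
  calc |v - t| * (v + t) ≤ C * t ^ 5 * (5 / 2 * t) := by gcongr
    _ = 10 * C * t ^ 2 * ((t / 2) ^ 2 * t ^ 2) := by ring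
    _ ≤ 10 * C * t ^ 2 * (v ^ 2 * t ^ 2) := by gcongr

/-! ### Extremal zeros and monotonicity -/

theorem exists_first_zero {a c : ℝ} {f : ℝ → ℝ} (hac : a ≤ c) (hf : ContinuousOn f (Icc a c))
    (ha : 0 < f a) (hc : f c = 0) :
    ∃ η ∈ Ioc a c, f η = 0 ∧ ∀ x ∈ Ico a η, 0 < f x := by
  have hcl : IsCompact {x ∈ Icc a c | f x = 0} :=
    isCompact_Icc.of_isClosed_subset
      (hf.preimage_isClosed_of_isClosed isClosed_Icc isClosed_singleton) (sep_subset _ _)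
  obtain ⟨η, ⟨hη1, hη2⟩, hη3⟩ := hcl.exists_isLeast ⟨c, right_mem_Icc.2 hac, hc⟩
  have hne : a ≠ η := fun h => by rw [← h] at hη2; exact ha.ne' hη2
  refine ⟨η, ⟨lt_of_le_of_ne hη1.1 hne, hη1.2⟩, hη2, fun x hx => ?_⟩
  by_contra! hx0
  obtain ⟨t, ht, ht0⟩ := intermediate_value_Icc' hx.1
    (hf.mono (Icc_subset_Icc_right (hx.2.le.trans hη1.2))) ⟨hx0, ha.le⟩
  have := hη3 ⟨⟨ht.1, ht.2.trans (hx.2.le.trans hη1.2)⟩, ht0⟩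
  linarith [ht.2, hx.2]

theorem exists_last_zero {a c : ℝ} {f : ℝ → ℝ} (hac : a ≤ c) (hf : ContinuousOn f (Icc a c))
    (hc : f c < 0) (ha : f a = 0) :
    ∃ ξ ∈ Ico a c, f ξ = 0 ∧ ∀ x ∈ Ioc ξ c, f x < 0 := by
  have hcont : ContinuousOn (fun x => -f (-x)) (Icc (-c) (-a)) :=
    (hf.comp continuousOn_neg fun x hx => ⟨by linarith [hx.2], by linarith [hx.1]⟩).neg
  obtain ⟨η, hη, h0, hpos⟩ := exists_first_zero (neg_le_neg hac) hcont (by simpa using hc)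
    (by simpa using ha)
  refine ⟨-η, ⟨by linarith [hη.2], by linarith [hη.1]⟩, by simpa using h0, fun x hx => ?_⟩
  have := hpos (-x) ⟨by linarith [hx.2], by linarith [hx.1]⟩
  simpa using this

theorem strictMonoOn_Icc_of_hasDerivAt {a b : ℝ} {f f' : ℝ → ℝ}
    (hf : ∀ x ∈ Icc a b, HasDerivAt f (f' x) x) (hpos : ∀ x ∈ Ioo a b, 0 < f' x) :
    StrictMonoOn f (Icc a b) :=
  strictMonoOn_of_hasDerivWithinAt_pos (convex_Icc a b)
    (fun x hx => (hf x hx).continuousAt.continuousWithinAt)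
    (fun x hx => (hf x (interior_subset hx)).hasDerivWithinAt)
    (fun x hx => hpos x (by rwa [interior_Icc] at hx))

theorem monotoneOn_Icc_of_hasDerivAt {a b : ℝ} {f f' : ℝ → ℝ}
    (hf : ∀ x ∈ Icc a b, HasDerivAt f (f' x) x) (hpos : ∀ x ∈ Icc a b, 0 ≤ f' x) :
    MonotoneOn f (Icc a b) :=
  monotoneOn_of_hasDerivWithinAt_nonneg (convex_Icc a b)
    (fun x hx => (hf x hx).continuousAt.continuousWithinAt)
    (fun x hx => (hf x (interior_subset hx)).hasDerivWithinAt)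
    (fun x hx => hpos x (interior_subset hx))

/-! ### Sum and difference of two solutions -/

section Difference

variable {I : Set ℝ} {y₁ p₁ y₂ p₂ : ℝ → ℝ}

theorem SystemOn.hasDerivAt_sub (h₁ : SystemOn (-1) I y₁ p₁) (h₂ : SystemOn (-1) I y₂ p₂)
    {x : ℝ} (hx : x ∈ I) : HasDerivAt (fun x => y₁ x - y₂ x) (p₁ x - p₂ x) x :=
  (h₁ x hx).1.sub (h₂ x hx).1

theorem SystemOn.hasDerivAt_add (h₁ : SystemOn (-1) I y₁ p₁) (h₂ : SystemOn (-1) I y₂ p₂)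
    {x : ℝ} (hx : x ∈ I) : HasDerivAt (fun x => y₁ x + y₂ x) (p₁ x + p₂ x) x :=
  (h₁ x hx).1.add (h₂ x hx).1

/-- The explicit variable `x` cancels, leaving a linear equation for the difference with the sum as
potential. -/
theorem SystemOn.hasDerivAt_deriv_sub (h₁ : SystemOn (-1) I y₁ p₁) (h₂ : SystemOn (-1) I y₂ p₂)
    {x : ℝ} (hx : x ∈ I) :
    HasDerivAt (fun x => p₁ x - p₂ x) (6 * (y₁ x + y₂ x) * (y₁ x - y₂ x)) x :=
  ((h₁ x hx).2.sub (h₂ x hx).2).congr_deriv (by ring)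

theorem SystemOn.hasDerivAt_deriv_add (h₁ : SystemOn (-1) I y₁ p₁) (h₂ : SystemOn (-1) I y₂ p₂)
    {x : ℝ} (hx : x ∈ I) :
    HasDerivAt (fun x => p₁ x + p₂ x)
      (3 * (y₁ x + y₂ x) ^ 2 + 3 * (y₁ x - y₂ x) ^ 2 - 2 * x) x :=
  ((h₁ x hx).2.add (h₂ x hx).2).congr_deriv (by ring)

/-- If the sum of two solutions is nondecreasing at an intersection point, there is no further
intersection to the right with non-positive abscissa. The proof compares the energies. -/
theorem SystemOn.false_of_nonneg_right {α β γ : ℝ} (hγ : γ ≤ 0)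
    (h₁ : SystemOn (-1) (Ioo α γ) y₁ p₁) (h₂ : SystemOn (-1) (Ioo α γ) y₂ p₂)
    (hβ : β ∈ Ioo α γ) (heq : y₁ β = y₂ β) (hr : p₂ β < p₁ β) (hP : 0 ≤ p₁ β + p₂ β)
    (hlim : Tendsto (fun x => y₁ x - y₂ x) (𝓝[<] γ) (𝓝 0)) : False := by
  have hw0 : y₁ β - y₂ β = 0 := sub_eq_zero.2 heq
  have hwβ : Tendsto (fun x => y₁ x - y₂ x) (𝓝[>] β) (𝓝 0) := by
    rw [← hw0]
    exact (h₁.hasDerivAt_sub h₂ hβ).continuousAt.tendsto.mono_left nhdsWithin_le_nhds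
  obtain ⟨c, hc, hc0⟩ := exists_hasDerivAt_eq_zero' hβ.2 hwβ hlim
    (fun x hx => h₁.hasDerivAt_sub h₂ ⟨hβ.1.trans hx.1, hx.2⟩)
  have hcI : ∀ x ∈ Icc β c, x ∈ Ioo α γ :=
    fun x hx => ⟨hβ.1.trans_le hx.1, hx.2.trans_lt hc.2⟩
  obtain ⟨η, hη, hη0, hηpos⟩ := exists_first_zero (f := fun x => p₁ x - p₂ x) hc.1.le
    (fun x hx => (h₁.hasDerivAt_deriv_sub h₂ (hcI x hx)).continuousAt.continuousWithinAt)
    (sub_pos.2 hr) hc0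
  have hI : ∀ x ∈ Icc β η, x ∈ Ioo α γ := fun x hx => hcI x ⟨hx.1, hx.2.trans hη.2⟩
  have hwmono : StrictMonoOn (fun x => y₁ x - y₂ x) (Icc β η) :=
    strictMonoOn_Icc_of_hasDerivAt (fun x hx => h₁.hasDerivAt_sub h₂ (hI x hx))
      (fun x hx => hηpos x ⟨hx.1.le, hx.2⟩)
  have hwpos : ∀ x ∈ Ioc β η, 0 < y₁ x - y₂ x := fun x hx => by
    have := hwmono (left_mem_Icc.2 hη.1.le) ⟨hx.1.le, hx.2⟩ hx.1
    simp only [hw0] at this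
    exact this
  -- This is twice the difference of the energies `y'²/2 - 2y³ + xy`. At `β` only the product of
  -- derivatives survives, at `η` only the other term, whose sign uses `η ≤ 0`.
  have hF : StrictMonoOn (fun x => (p₁ x + p₂ x) * (p₁ x - p₂ x) -
      (y₁ x - y₂ x) * (3 * (y₁ x + y₂ x) ^ 2 + (y₁ x - y₂ x) ^ 2 - 2 * x)) (Icc β η) := by
    refine strictMonoOn_Icc_of_hasDerivAt (f' := fun x => 2 * (y₁ x - y₂ x)) (fun x hx => ?_)
      (fun x hx => mul_pos two_pos (hwpos x ⟨hx.1, hx.2.le⟩))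
    have hu := h₁.hasDerivAt_add h₂ (hI x hx)
    have hw := h₁.hasDerivAt_sub h₂ (hI x hx)
    have hp := h₁.hasDerivAt_deriv_add h₂ (hI x hx)
    have hr := h₁.hasDerivAt_deriv_sub h₂ (hI x hx)
    refine ((hp.mul hr).sub (hw.mul ((((hu.pow 2).const_mul 3).add (hw.pow 2)).sub
      ((hasDerivAt_id x).const_mul 2)))).congr_deriv ?_
    simp
    ring
  have h1 := hF (left_mem_Icc.2 hη.1.le) (right_mem_Icc.2 hη.1.le) hη.1
  simp only [hη0, hw0] at h1
  have h2 : 0 ≤ (p₁ β + p₂ β) * (p₁ β - p₂ β) := mul_nonneg hP (sub_pos.2 hr).le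
  have h3 : 0 ≤ (y₁ η - y₂ η) * (3 * (y₁ η + y₂ η) ^ 2 + (y₁ η - y₂ η) ^ 2 - 2 * η) := by
    have : η ≤ 0 := (hI η (right_mem_Icc.2 hη.1.le)).2.le.trans hγ
    refine mul_nonneg (hwpos η (right_mem_Ioc.2 hη.1)).le ?_
    have := sq_nonneg (y₁ η + y₂ η)
    have := sq_nonneg (y₁ η - y₂ η)
    linarith
  linarith

/-- If the sum of two solutions is decreasing at an intersection point, there is no further
intersection to the left. The proof compares the difference `w` with the linearization of
`u'' = 3 u ^ 2` along its solution with the same initial values as `y₁ + y₂`. -/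
theorem SystemOn.false_of_neg_left {α β γ : ℝ} (hγ : γ ≤ 0)
    (h₁ : SystemOn (-1) (Ioo α γ) y₁ p₁) (h₂ : SystemOn (-1) (Ioo α γ) y₂ p₂)
    (hβ : β ∈ Ioo α γ) (heq : y₁ β = y₂ β) (hr : p₁ β < p₂ β) (hP : p₁ β + p₂ β < 0)
    (hlim : Tendsto (fun x => y₁ x - y₂ x) (𝓝[>] α) (𝓝 0)) : False := by
  have hw0 : y₁ β - y₂ β = 0 := sub_eq_zero.2 heq
  have hwβ : Tendsto (fun x => y₁ x - y₂ x) (𝓝[<] β) (𝓝 0) := by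
    rw [← hw0]
    exact (h₁.hasDerivAt_sub h₂ hβ).continuousAt.tendsto.mono_left nhdsWithin_le_nhds
  obtain ⟨c, hc, hc0⟩ := exists_hasDerivAt_eq_zero' hβ.1 hlim hwβ
    (fun x hx => h₁.hasDerivAt_sub h₂ ⟨hx.1, hx.2.trans hβ.2⟩)
  have hcI : ∀ x ∈ Icc c β, x ∈ Ioo α γ :=
    fun x hx => ⟨hc.1.trans_le hx.1, hx.2.trans_lt hβ.2⟩
  obtain ⟨ξ, hξ, hξ0, hξneg⟩ := exists_last_zero (f := fun x => p₁ x - p₂ x) hc.2.le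
    (fun x hx => (h₁.hasDerivAt_deriv_sub h₂ (hcI x hx)).continuousAt.continuousWithinAt)
    (sub_neg.2 hr) hc0
  have hξβ := hξ.2
  have hI : ∀ x ∈ Icc ξ β, x ∈ Ioo α γ := fun x hx => hcI x ⟨hξ.1.trans hx.1, hx.2⟩
  have hξm : ξ ∈ Icc ξ β := left_mem_Icc.2 hξβ.le
  have hβm : β ∈ Icc ξ β := right_mem_Icc.2 hξβ.le
  have hwpos : ∀ x ∈ Ico ξ β, 0 < y₁ x - y₂ x := fun x hx => by
    have := strictMonoOn_Icc_of_hasDerivAt (fun x hx => (h₁.hasDerivAt_sub h₂ (hI x hx)).neg)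
      (fun x hx => neg_pos.2 (hξneg x ⟨hx.1, hx.2.le⟩)) ⟨hx.1, hx.2.le⟩ hβm hx.2
    simp only [Pi.neg_apply, hw0] at this
    linarith
  have hwnn : ∀ x ∈ Icc ξ β, 0 ≤ y₁ x - y₂ x := fun x hx => by
    rcases hx.2.lt_or_eq with h | h
    · exact (hwpos x ⟨hx.1, h⟩).le
    · rw [h, hw0]
  -- Otherwise `w''(ξ) = 6uw > 0`, and `w'` would be positive just to the right of its zero `ξ`.
  have huξ : y₁ ξ + y₂ ξ ≤ 0 := by
    by_contra! hu
    have hpos : 0 < 6 * (y₁ ξ + y₂ ξ) * (y₁ ξ - y₂ ξ) :=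
      mul_pos (by linarith) (hwpos ξ ⟨le_rfl, hξβ⟩)
    have hs := (hasDerivWithinAt_iff_tendsto_slope' (self_notMem_Ioi (a := ξ))).1
      (h₁.hasDerivAt_deriv_sub h₂ (hI ξ hξm)).hasDerivWithinAt
    obtain ⟨x, hx1, hx2⟩ := ((hs.eventually_const_lt hpos).and (Ioo_mem_nhdsGT hξβ)).exists
    rw [slope_def_field, hξ0, sub_zero] at hx1
    have := hξneg x ⟨hx2.1, hx2.2.le⟩
    exact hx1.not_ge (div_nonpos_of_nonpos_of_nonneg this.le (sub_pos.2 hx2.1).le)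
  have hP' : ∀ x ∈ Icc ξ β,
      0 ≤ 3 * (y₁ x - y₂ x) ^ 2 - 2 * x := fun x hx => by
    have h1 : x ≤ 0 := (hI x hx).2.le.trans hγ
    have := sq_nonneg (y₁ x - y₂ x)
    linarith
  have hPneg : ∀ x ∈ Icc ξ β, p₁ x + p₂ x < 0 := fun x hx => by
    have := monotoneOn_Icc_of_hasDerivAt (fun x hx => h₁.hasDerivAt_deriv_add h₂ (hI x hx))
      (fun x hx => by linarith [hP' x hx, sq_nonneg (y₁ x + y₂ x)]) hx hβm hx.2
    simp only at this
    linarith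
  have hanti := monotoneOn_Icc_of_hasDerivAt
    (fun x hx => (h₁.hasDerivAt_add h₂ (hI x hx)).neg)
    (fun x hx => (neg_pos.2 (hPneg x hx)).le)
  have hule : ∀ x ∈ Icc ξ β, y₁ x + y₂ x ≤ 0 := fun x hx => by
    have := hanti hξm hx hx.1
    simp only [Pi.neg_apply] at this
    linarith
  have huge : ∀ x ∈ Icc ξ β, y₁ β + y₂ β ≤ y₁ x + y₂ x := fun x hx => by
    have := hanti hx hβm hx.2
    simp only [Pi.neg_apply] at this
    linarith
  -- `v'² - 2v³` is a first integral of `v'' = 3v²`. With `k` its value for the data of `u` at `β`,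
  -- `T` is the square of the slope of `v` at height `u x`, so the comparison is made at equal
  -- heights rather than equal abscissas.
  set k : ℝ := (p₁ β + p₂ β) ^ 2 - 2 * (y₁ β + y₂ β) ^ 3 with hk
  have hPβ : 0 < (p₁ β + p₂ β) ^ 2 := sq_pos_of_neg hP
  have hk0 : 0 < k := by
    have : (y₁ β + y₂ β) ^ 3 ≤ 0 := Odd.pow_nonpos (by decide) (hule β hβm)
    linarith
  set T : ℝ → ℝ := fun x => 2 * (y₁ x + y₂ x) ^ 3 + k with hT
  have hTpos : ∀ x ∈ Icc ξ β, 0 < T x := fun x hx => by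
    have : (y₁ β + y₂ β) ^ 3 ≤ (y₁ x + y₂ x) ^ 3 := (Odd.strictMono_pow (by decide)).monotone
      (huge x hx)
    simp only [hT, hk]
    linarith
  have hTle : ∀ x ∈ Icc ξ β, T x ≤ (p₁ x + p₂ x) ^ 2 := fun x hx => by
    have := monotoneOn_Icc_of_hasDerivAt
      (f := fun x => 2 * (y₁ x + y₂ x) ^ 3 - (p₁ x + p₂ x) ^ 2)
      (f' := fun x => 2 * -(p₁ x + p₂ x) * (3 * (y₁ x - y₂ x) ^ 2 - 2 * x)) (fun x hx => by
        refine ((((h₁.hasDerivAt_add h₂ (hI x hx)).pow 3).const_mul 2).sub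
          ((h₁.hasDerivAt_deriv_add h₂ (hI x hx)).pow 2)).congr_deriv ?_
        push_cast
        ring)
      (fun x hx => mul_nonneg (by linarith [hPneg x hx]) (hP' x hx)) hx hβm hx.2
    simp only at this
    simp only [hT, hk]
    linarith
  have hSle : ∀ x ∈ Icc ξ β, √(T x) + (p₁ x + p₂ x) ≤ 0 := fun x hx => by
    have : √(T x) ≤ -(p₁ x + p₂ x) :=
      Real.sqrt_le_iff.2 ⟨by linarith [hPneg x hx], by rw [neg_sq]; exact hTle x hx⟩
    linarith
  have hTd : ∀ x ∈ Icc ξ β,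
      HasDerivAt T (6 * (y₁ x + y₂ x) ^ 2 * (p₁ x + p₂ x)) x := fun x hx => by
    refine ((((h₁.hasDerivAt_add h₂ (hI x hx)).pow 3).const_mul 2).add_const k).congr_deriv ?_
    push_cast
    ring
  have hcT : ContinuousOn T (Icc ξ β) :=
    fun x hx => (hTd x hx).continuousAt.continuousWithinAt
  have hcu : ContinuousOn (fun x => y₁ x + y₂ x) (Icc ξ β) :=
    fun x hx => (h₁.hasDerivAt_add h₂ (hI x hx)).continuousAt.continuousWithinAt
  have hcp : ContinuousOn (fun x => p₁ x + p₂ x) (Icc ξ β) :=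
    fun x hx => (h₁.hasDerivAt_deriv_add h₂ (hI x hx)).continuousAt.continuousWithinAt
  -- `v' = -√T` solves the linearized equation `φ'' = 6vφ` and has derivative `3v²`; `f` is minus
  -- the Wronskian `w'v' - wv''` read at height `v = u`.
  have hend := nonneg_of_mul_le_deriv hξβ.le
    (f := fun x => (p₁ x - p₂ x) * √(T x) + 3 * (y₁ x + y₂ x) ^ 2 * (y₁ x - y₂ x))
    (f' := fun x => (√(T x) + (p₁ x + p₂ x)) / √(T x) *
      (6 * (y₁ x + y₂ x) * (y₁ x - y₂ x) * √(T x) + 3 * (y₁ x + y₂ x) ^ 2 * (p₁ x - p₂ x)))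
    (h := fun x => (√(T x) + (p₁ x + p₂ x)) * (3 * (y₁ x + y₂ x) ^ 2) / T x)
    (((hcT.sqrt.add hcp).mul ((hcu.pow 2).const_mul 3)).div hcT fun x hx => (hTpos x hx).ne')
    (fun x hx => by
      have hS : 0 < √(T x) := Real.sqrt_pos.2 (hTpos x hx)
      refine (((h₁.hasDerivAt_deriv_sub h₂ (hI x hx)).mul ((hTd x hx).sqrt (hTpos x hx).ne')).add
        ((((h₁.hasDerivAt_add h₂ (hI x hx)).pow 2).const_mul 3).mul
          (h₁.hasDerivAt_sub h₂ (hI x hx)))).congr_deriv ?_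
      simp only [Pi.pow_apply]
      push_cast
      field_simp
      ring)
    (fun x hx => by
      have hS : 0 < √(T x) := Real.sqrt_pos.2 (hTpos x hx)
      have hST : T x = √(T x) ^ 2 := (Real.sq_sqrt (hTpos x hx).le).symm
      have hTu : T x = 2 * (y₁ x + y₂ x) ^ 3 + k := rfl
      have h1 := hSle x hx
      have h2 := hwnn x hx
      have h3 := hule x hx
      have h4 := hTpos x hx
      set S := √(T x)
      set u := y₁ x + y₂ x
      set w := y₁ x - y₂ x
      set P := p₁ x + p₂ x
      set r := p₁ x - p₂ x
      -- This sign is what makes `f' - h f` nonnegative: the three factors `S + P`, `w` and this one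
      -- have signs `≤ 0`, `≥ 0`, `≤ 0`.
      have h5 : 6 * u * S ^ 2 - 9 * u ^ 4 ≤ 0 := by
        have : 6 * u * S ^ 2 - 9 * u ^ 4 = 3 / 2 * u * (T x + 3 * k) := by
          rw [← hST, hTu]; ring
        rw [this]
        exact mul_nonpos_of_nonpos_of_nonneg (by linarith) (by linarith)
      have h6 : 0 ≤ (S + P) * (w * (6 * u * S ^ 2 - 9 * u ^ 4)) :=
        mul_nonneg_of_nonpos_of_nonpos h1 (mul_nonpos_of_nonneg_of_nonpos h2 h5)
      have h7 : (S + P) / S * (6 * u * w * S + 3 * u ^ 2 * r) -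
          (S + P) * (3 * u ^ 2) / S ^ 2 * (r * S + 3 * u ^ 2 * w) =
          (S + P) * (w * (6 * u * S ^ 2 - 9 * u ^ 4)) / S ^ 2 := by
        field_simp; ring
      have h8 : 0 ≤ (S + P) * (w * (6 * u * S ^ 2 - 9 * u ^ 4)) / S ^ 2 := by positivity
      show (S + P) * (3 * u ^ 2) / T x * (r * S + 3 * u ^ 2 * w) ≤
        (S + P) / S * (6 * u * w * S + 3 * u ^ 2 * r)
      rw [hST]
      linarith)
    (by
      have := hwnn ξ hξm
      simp only [hξ0, zero_mul, zero_add]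
      positivity)
  simp only [hw0, mul_zero, add_zero] at hend
  have : (p₁ β - p₂ β) * √(T β) < 0 :=
    mul_neg_of_neg_of_pos (sub_neg.2 hr) (Real.sqrt_pos.2 (hTpos β hβm))
  linarith

/-- The difference of two solutions cannot vanish transversally at `β` and tend to zero at both end
points of an interval around `β` on the non-positive axis. -/
theorem SystemOn.false_of_tendsto {α β γ : ℝ} (hγ : γ ≤ 0)
    (h₁ : SystemOn (-1) (Ioo α γ) y₁ p₁) (h₂ : SystemOn (-1) (Ioo α γ) y₂ p₂)
    (hβ : β ∈ Ioo α γ) (heq : y₁ β = y₂ β) (hr : p₁ β ≠ p₂ β)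
    (hα : Tendsto (fun x => y₁ x - y₂ x) (𝓝[>] α) (𝓝 0))
    (hγ' : Tendsto (fun x => y₁ x - y₂ x) (𝓝[<] γ) (𝓝 0)) : False := by
  have hα' : Tendsto (fun x => y₂ x - y₁ x) (𝓝[>] α) (𝓝 0) := by simpa using hα.neg
  have hγ'' : Tendsto (fun x => y₂ x - y₁ x) (𝓝[<] γ) (𝓝 0) := by simpa using hγ'.neg
  -- Exchanging the two solutions changes the sign of `w'(β)` but not of `u'(β)`, so only two cases
  -- are genuine.
  rcases le_or_gt 0 (p₁ β + p₂ β) with hP | hP <;> rcases hr.lt_or_gt with hr | hr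
  · exact h₂.false_of_nonneg_right hγ h₁ hβ heq.symm hr (by linarith) hγ''
  · exact h₁.false_of_nonneg_right hγ h₂ hβ heq hr hP hγ'
  · exact h₁.false_of_neg_left hγ h₂ hβ heq hr hP hα
  · exact h₂.false_of_neg_left hγ h₁ hβ heq.symm hr (by linarith) hα'

end Difference

/-! ### Expansion at the end points of the interval of existence -/

theorem IsEndPoint.notMem {I : Set ℝ} (hI : IsOpen I) {p : ℝ} (h : IsEndPoint I p) : p ∉ I := by
  intro hp
  obtain ⟨l, u, hlu, hsub⟩ := mem_nhds_iff_exists_Ioo_subset.1 (hI.mem_nhds hp)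
  rcases h with h | h
  · obtain ⟨t, ht1, ht2⟩ := exists_between hlu.1
    exact (h.1 (hsub ⟨ht1, ht2.trans hlu.2⟩)).not_gt ht2
  · obtain ⟨t, ht1, ht2⟩ := exists_between hlu.2
    exact (h.1 (hsub ⟨hlu.1.trans ht1, ht2⟩)).not_gt ht1

namespace IsSolution

variable {I : Set ℝ} {y : ℝ → ℝ}

theorem ordConnected (h : IsSolution I y) : I.OrdConnected :=
  h.isConnected.isPreconnected.ordConnected

/-- The expansion of a solution at the right end point of its interval of existence. -/
theorem tendsto_of_isLUB (h : IsSolution I y) {b : ℝ} (hb : IsLUB I b) :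
    Tendsto (fun x => y x - ((b - x) ^ 2)⁻¹) (𝓝[<] b) (𝓝 0) := by
  have hbI : b ∉ I := IsEndPoint.notMem h.isOpen (Or.inr hb)
  have hlt : ∀ x ∈ I, x < b := fun x hx =>
    lt_of_le_of_ne (hb.1 hx) fun hxb => hbI (hxb ▸ hx)
  obtain ⟨a, ha⟩ := h.isConnected.nonempty
  have hab := hlt a ha
  have hsub : Ioo a b ⊆ I := fun x hx => by
    obtain ⟨c, hc, hxc⟩ := (lt_isLUB_iff hb).1 hx.2
    exact h.ordConnected.out ha hc ⟨hx.1.le, hxc.le⟩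
  have hs : SystemOn (-1) (Ioo a b) y (deriv y) := h.solves.systemOn.mono hsub
  -- Finite limits would permit a continuation past `b`, against maximality.
  obtain ⟨hy, hp⟩ := hs.tendsto_atTop hab (fun y₀ p₀ hy hp => by
    obtain ⟨s, c, has, hsb, hbc, z, q, hz, hzy⟩ := hs.exists_extension hab hy hp
    obtain ⟨m, hm⟩ := nonempty_Ioo.2 hsb
    refine hbI (h.subset isOpen_Ioo isPreconnected_Ioo
      ⟨m, hsub ⟨has.trans_lt hm.1, hm.2⟩, hm.1, hm.2.trans hbc⟩ (hz.solvesOn isOpen_Ioo)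
      (fun x hx => hzy ⟨hx.2.1, hlt x hx.1⟩) ⟨hsb, hbc⟩))
  exact tendsto_sub_inv_sq ((eventually_mem_Ioo_nhdsLT hab).mono hs) hy hp

/-- The expansion of a solution at the left end point of its interval of existence. -/
theorem tendsto_of_isGLB (h : IsSolution I y) {a : ℝ} (ha : IsGLB I a) :
    Tendsto (fun x => y x - ((x - a) ^ 2)⁻¹) (𝓝[>] a) (𝓝 0) := by
  have haI : a ∉ I := IsEndPoint.notMem h.isOpen (Or.inl ha)
  have hlt : ∀ x ∈ I, a < x := fun x hx =>
    lt_of_le_of_ne (ha.1 hx) fun hxa => haI (hxa ▸ hx)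
  obtain ⟨b, hb⟩ := h.isConnected.nonempty
  have hab := neg_lt_neg (hlt b hb)
  have hsub : Ioo (-b) (-a) ⊆ {x | -x ∈ I} := fun x hx => by
    obtain ⟨c, hc, hxc⟩ := (isGLB_lt_iff ha).1 (lt_neg_of_lt_neg hx.2)
    exact h.ordConnected.out hc hb ⟨hxc.le, by linarith [hx.1]⟩
  -- Reflection turns the left end point into a right one, at the price of `σ = 1`; the right end
  -- point results hold for every `σ`.
  have hs := h.solves.systemOn.reflect.mono hsub
  obtain ⟨hy, hp⟩ := hs.tendsto_atTop hab (fun y₀ p₀ hy hp => by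
    obtain ⟨s, c, has, hsb, hbc, z, q, hz, hzy⟩ := hs.exists_extension hab hy hp
    obtain ⟨m, hm⟩ := nonempty_Ioo.2 hsb
    have hz' : SystemOn (-1) (Ioo (-c) (-s)) (fun x => z (-x)) (fun x => -q (-x)) := by
      have := hz.reflect.mono (J := Ioo (-c) (-s))
        fun x hx => ⟨by linarith [hx.2], by linarith [hx.1]⟩
      rwa [neg_neg] at this
    refine haI (h.subset isOpen_Ioo isPreconnected_Ioo
      ⟨-m, hsub ⟨has.trans_lt hm.1, hm.2⟩, by linarith [hm.2], by linarith [hm.1]⟩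
      (hz'.solvesOn isOpen_Ioo)
      (fun x hx => ?_) ⟨by linarith, by linarith⟩)
    have := hzy (x := -x) ⟨by linarith [hx.2.2], neg_lt_neg (hlt x hx.1)⟩
    simpa using this)
  have hneg : Tendsto (fun x : ℝ => -x) (𝓝[>] a) (𝓝[<] (-a)) :=
    tendsto_nhdsWithin_of_tendsto_nhds_of_eventually_within _
      (continuous_neg.continuousAt.mono_left nhdsWithin_le_nhds)
      (by filter_upwards [self_mem_nhdsWithin] with x hx using neg_lt_neg (mem_Ioi.1 hx))
  refine ((tendsto_sub_inv_sq ((eventually_mem_Ioo_nhdsLT hab).mono hs) hy hp).comp hneg).congr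
    fun x => ?_
  simp only [Function.comp_apply, neg_neg]
  ring_nf

end IsSolution

/-! ### Intersection points of two solutions -/

section TwoSolutions

variable {I₁ I₂ : Set ℝ} {y₁ y₂ : ℝ → ℝ}

theorem mem_or_isGLB {I : Set ℝ} {a c : ℝ} (ha : a ∈ I ∨ IsEndPoint I a)
    (hc : c ∈ I ∨ IsEndPoint I c) (hne : I.Nonempty) (hac : a < c) : a ∈ I ∨ IsGLB I a := by
  rcases ha with ha | ha | ha
  · exact Or.inl ha
  · exact Or.inr ha
  · exfalso
    obtain ⟨x, hx⟩ := hne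
    rcases hc with hc | hc | hc
    · exact (ha.1 hc).not_gt hac
    · exact ((hc.1 hx).trans (ha.1 hx)).not_gt hac
    · exact hac.ne (ha.unique hc)

theorem mem_or_isLUB {I : Set ℝ} {a c : ℝ} (ha : a ∈ I ∨ IsEndPoint I a)
    (hc : c ∈ I ∨ IsEndPoint I c) (hne : I.Nonempty) (hac : a < c) : c ∈ I ∨ IsLUB I c := by
  rcases hc with hc | hc | hc
  · exact Or.inl hc
  · exfalso
    obtain ⟨x, hx⟩ := hne
    rcases ha with ha | ha | ha
    · exact (hc.1 ha).not_gt hac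
    · exact hac.ne (ha.unique hc)
    · exact ((hc.1 hx).trans (ha.1 hx)).not_gt hac
  · exact Or.inr hc

theorem Ioo_subset_of_mem_or_isEndPoint {I : Set ℝ} (hI : I.OrdConnected) {a c : ℝ}
    (ha : a ∈ I ∨ IsEndPoint I a) (hc : c ∈ I ∨ IsEndPoint I c) (hne : I.Nonempty) :
    Ioo a c ⊆ I := by
  intro x hx
  have hac := hx.1.trans hx.2
  have h1 : ∃ s ∈ I, s < x := (mem_or_isGLB ha hc hne hac).elim (fun h => ⟨a, h, hx.1⟩)
    fun h => (isGLB_lt_iff h).1 hx.1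
  have h2 : ∃ t ∈ I, x < t := (mem_or_isLUB ha hc hne hac).elim (fun h => ⟨c, h, hx.2⟩)
    fun h => (lt_isLUB_iff h).1 hx.2
  obtain ⟨s, hs, hsx⟩ := h1
  obtain ⟨t, ht, hxt⟩ := h2
  exact hI.out hs ht ⟨hsx.le, hxt.le⟩

theorem mem_or_isEndPoint_of_mem_extendedGraph {I : Set ℝ} {y : ℝ → ℝ} {P : ℝ × OnePoint ℝ}
    (h : P ∈ extendedGraph I y) : P.1 ∈ I ∨ IsEndPoint I P.1 :=
  h.imp And.left And.left

/-- An intersection point is a finite one or a common end point. -/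
theorem mem_intersectionPoints_cases {P : ℝ × OnePoint ℝ}
    (h : P ∈ intersectionPoints I₁ y₁ I₂ y₂) :
    (P.1 ∈ I₁ ∧ P.1 ∈ I₂ ∧ y₁ P.1 = y₂ P.1 ∧ P.2 = ((y₁ P.1 : ℝ) : OnePoint ℝ)) ∨
      (IsEndPoint I₁ P.1 ∧ IsEndPoint I₂ P.1 ∧ P.2 = OnePoint.infty) := by
  obtain ⟨h1 | h1, h2 | h2⟩ := h
  · exact Or.inl ⟨h1.1, h2.1, OnePoint.coe_injective (h1.2.symm.trans h2.2), h1.2⟩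
  · exact absurd (h1.2.symm.trans h2.2) (OnePoint.coe_ne_infty _)
  · exact absurd (h2.2.symm.trans h1.2) (OnePoint.coe_ne_infty _)
  · exact Or.inr ⟨h1.1, h2.1, h1.2⟩

/-- An open interval does not contain its end points, so no abscissa carries both a finite point and
a point at infinity. Counting points thus reduces to ordering abscissas. -/
theorem injOn_fst_intersectionPoints (hI : IsOpen I₁) :
    InjOn Prod.fst (intersectionPoints I₁ y₁ I₂ y₂) := by
  intro P hP Q hQ hPQ
  refine Prod.ext hPQ ?_
  rcases mem_intersectionPoints_cases hP with h | h <;>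
    rcases mem_intersectionPoints_cases hQ with h' | h'
  · rw [h.2.2.2, h'.2.2.2, hPQ]
  · exact absurd (hPQ ▸ h.1) (h'.1.notMem hI)
  · exact absurd (hPQ ▸ h'.1) (h.1.notMem hI)
  · rw [h.2.2, h'.2.2]

/-- Different solutions intersect transversally. -/
theorem IsSolution.deriv_ne (h₁ : IsSolution I₁ y₁) (h₂ : IsSolution I₂ y₂)
    (hne : ¬ (I₁ = I₂ ∧ EqOn y₁ y₂ I₁)) {x : ℝ} (hx₁ : x ∈ I₁) (hx₂ : x ∈ I₂)
    (heq : y₁ x = y₂ x) : deriv y₁ x ≠ deriv y₂ x := by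
  intro hd
  have hon : EqOn y₁ y₂ (I₁ ∩ I₂) :=
    (h₁.solves.systemOn.mono inter_subset_left).eqOn
      (h₁.ordConnected.inter h₂.ordConnected) (h₂.solves.systemOn.mono inter_subset_right)
      ⟨hx₁, hx₂⟩ heq hd
  have h21 : I₂ ⊆ I₁ := h₁.subset h₂.isOpen h₂.isConnected.isPreconnected ⟨x, hx₁, hx₂⟩
    h₂.solves hon.symm
  have h12 : I₁ ⊆ I₂ := h₂.subset h₁.isOpen h₁.isConnected.isPreconnected ⟨x, hx₂, hx₁⟩
    h₁.solves (by rwa [inter_comm])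
  exact hne ⟨h12.antisymm h21, fun t ht => hon ⟨ht, h12 ht⟩⟩

/-- Both intervals of existence contain the open interval between the outer abscissas, so the middle
point is finite. At an outer point at infinity the two expansions have the same singular term, which
cancels in the difference. -/
theorem IsSolution.false_of_three_intersections (h₁ : IsSolution I₁ y₁) (h₂ : IsSolution I₂ y₂)
    (hne : ¬ (I₁ = I₂ ∧ EqOn y₁ y₂ I₁)) {P Q R : ℝ × OnePoint ℝ}
    (hP : P ∈ intersectionPoints I₁ y₁ I₂ y₂) (hQ : Q ∈ intersectionPoints I₁ y₁ I₂ y₂)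
    (hR : R ∈ intersectionPoints I₁ y₁ I₂ y₂) (hPQ : P.1 < Q.1) (hQR : Q.1 < R.1)
    (hR0 : R.1 ≤ 0) : False := by
  have hn₁ := h₁.isConnected.nonempty
  have hn₂ := h₂.isConnected.nonempty
  have hPR := hPQ.trans hQR
  have hP₁ := mem_or_isEndPoint_of_mem_extendedGraph hP.1
  have hP₂ := mem_or_isEndPoint_of_mem_extendedGraph hP.2
  have hR₁ := mem_or_isEndPoint_of_mem_extendedGraph hR.1
  have hR₂ := mem_or_isEndPoint_of_mem_extendedGraph hR.2
  have hs₁ := Ioo_subset_of_mem_or_isEndPoint h₁.ordConnected hP₁ hR₁ hn₁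
  have hs₂ := Ioo_subset_of_mem_or_isEndPoint h₂.ordConnected hP₂ hR₂ hn₂
  have hQm : Q.1 ∈ Ioo P.1 R.1 := ⟨hPQ, hQR⟩
  have heq : y₁ Q.1 = y₂ Q.1 := by
    rcases mem_intersectionPoints_cases hQ with h | h
    · exact h.2.2.1
    · exact absurd (hs₁ hQm) (h.1.notMem h₁.isOpen)
  have hcont : ∀ x, x ∈ I₁ → x ∈ I₂ → y₁ x = y₂ x →
      Tendsto (fun x => y₁ x - y₂ x) (𝓝 x) (𝓝 0) := fun x hx₁ hx₂ hx => by
    have := ((h₁.solves x hx₁).1.continuousAt.sub (h₂.solves x hx₂).1.continuousAt).tendsto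
    rwa [Pi.sub_apply, hx, sub_self] at this
  refine SystemOn.false_of_tendsto hR0 (h₁.solves.systemOn.mono hs₁) (h₂.solves.systemOn.mono hs₂)
    hQm heq (h₁.deriv_ne h₂ hne (hs₁ hQm) (hs₂ hQm) heq) ?_ ?_
  · rcases mem_intersectionPoints_cases hP with h | h
    · exact (hcont _ h.1 h.2.1 h.2.2.1).mono_left nhdsWithin_le_nhds
    · have e₁ := (mem_or_isGLB hP₁ hR₁ hn₁ hPR).resolve_left (h.1.notMem h₁.isOpen)
      have e₂ := (mem_or_isGLB hP₂ hR₂ hn₂ hPR).resolve_left (h.2.1.notMem h₂.isOpen)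
      simpa using (h₁.tendsto_of_isGLB e₁).sub (h₂.tendsto_of_isGLB e₂)
  · rcases mem_intersectionPoints_cases hR with h | h
    · exact (hcont _ h.1 h.2.1 h.2.2.1).mono_left nhdsWithin_le_nhds
    · have e₁ := (mem_or_isLUB hP₁ hR₁ hn₁ hPR).resolve_left (h.1.notMem h₁.isOpen)
      have e₂ := (mem_or_isLUB hP₂ hR₂ hn₂ hPR).resolve_left (h.2.1.notMem h₂.isOpen)
      simpa using (h₁.tendsto_of_isLUB e₁).sub (h₂.tendsto_of_isLUB e₂)

end TwoSolutions

end PainleveI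

theorem theorem6p1 (I₁ I₂ : Set ℝ) (y₁ y₂ : ℝ → ℝ)
    (h₁ : PainleveI.IsSolution I₁ y₁) (h₂ : PainleveI.IsSolution I₂ y₂)
    (hne : ¬ (I₁ = I₂ ∧ Set.EqOn y₁ y₂ I₁)) :
    {P ∈ PainleveI.intersectionPoints I₁ y₁ I₂ y₂ | P.1 ≤ 0}.encard ≤ 2 := by
  by_contra! hcard
  have h3 : (3 : ℕ∞) ≤ {P ∈ PainleveI.intersectionPoints I₁ y₁ I₂ y₂ | P.1 ≤ 0}.encard :=
    Order.add_one_le_of_lt hcard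
  obtain ⟨t, hts, ht⟩ := Set.exists_subset_encard_eq h3
  obtain ⟨P, Q, R, hPQ, hPR, hQR, rfl⟩ := Set.encard_eq_three.1 ht
  have hP := hts (show P ∈ ({P, Q, R} : Set _) by simp)
  have hQ := hts (show Q ∈ ({P, Q, R} : Set _) by simp)
  have hR := hts (show R ∈ ({P, Q, R} : Set _) by simp)
  have hinj := PainleveI.injOn_fst_intersectionPoints (y₁ := y₁) (I₂ := I₂) (y₂ := y₂) h₁.isOpen
  have key : ∀ {A B C : ℝ × OnePoint ℝ},
      A ∈ {P ∈ PainleveI.intersectionPoints I₁ y₁ I₂ y₂ | P.1 ≤ 0} →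
      B ∈ {P ∈ PainleveI.intersectionPoints I₁ y₁ I₂ y₂ | P.1 ≤ 0} →
      C ∈ {P ∈ PainleveI.intersectionPoints I₁ y₁ I₂ y₂ | P.1 ≤ 0} →
      A.1 < B.1 → B.1 < C.1 → False := fun hA hB hC hAB hBC =>
    h₁.false_of_three_intersections h₂ hne hA.1 hB.1 hC.1 hAB hBC hC.2
  -- Of the eight sign patterns six are orderings of `P`, `Q`, `R`; the two cyclic ones are
  -- impossible.
  rcases lt_or_gt_of_ne (hinj.ne hP.1 hQ.1 hPQ) with h | h <;>
    rcases lt_or_gt_of_ne (hinj.ne hP.1 hR.1 hPR) with h' | h' <;>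
    rcases lt_or_gt_of_ne (hinj.ne hQ.1 hR.1 hQR) with h'' | h''
  · exact key hP hQ hR h h''
  · exact key hP hR hQ h' h''
  · exact lt_asymm h' (h.trans h'')
  · exact key hR hP hQ h' h
  · exact key hQ hP hR h h'
  · exact lt_asymm h' (h''.trans h)
  · exact key hQ hR hP h'' h'
  · exact key hR hQ hP h'' h
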